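/- Let $n,d\ge 1$, $K\ge 0$, and let $f=\frac1n\sum_{i=1}^n f_i$ with $f_i:\mathbb R^d\to\mathbb R$ differentiable, $\|\nabla f_i(x)-\nabla f_i(y)\|\le L_i\|x-y\|$ for all $x,y$, $f$ $L$-smooth in the same sense, and $f\ge f^{\inf}>-\infty$. Put $L_{\max}=\max_i L_i$. **Algorithm (DP-$\alpha$-NormEC).** Given $\gamma,\beta,\alpha>0$, $x^0,g_1^0,\dots,g_n^0\in\mathbb R^d$ and $\hat g^0=\frac1n\sum_i g_i^0$, for $k=0,\dots,K$ and all $i$ set $$\Delta_i^k=\frac{\nabla f_i(x^k)-g_i^k}{\alpha+\|\nabla f_i(x^k)-g_i^k\|},\quad g_i^{k+1}=g_i^k+\beta\Delta_i^k,\quad \hat\Delta_i^k=\Delta_i^k+z_i^k,$$ $$\hat g^{k+1}=\hat g^k+\frac{\beta}{n}\sum_{i=1}^n\hat\Delta_i^k,\qquad x^{k+1}=x^k-\gamma\,\frac{\hat g^{k+1}}{\|\hat g^{k+1}\|}\qquad(0/0:=0),$$ where the $z_i^k$ are independent $N(0,\sigma_{\rm DP}^2 I_d)$ vectors. Client $i$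 sends $\hat\Delta_i^k$ to the server; the output is $x^{K+1}$. **Differential privacy.** Two tuples $(f_i)_i$, $(f_i')_i$ of differentiable functions are neighbouring if $f_i=f_i'$ for all $i$ but at most one. For fixed inputs $\gamma,\beta,\alpha,x^0,(g_i^0)_i,\sigma_{\rm DP},K$, the algorithm is $(\epsilon,\delta)$-differentially private if $\Pr[T(f)\in S]\le e^{\epsilon}\Pr[T(f')\in S]+\delta$ for all neighbouring $(f_i)_i,(f'_i)_i$ and all measurable $S$, where $T$ consists of all messages $(\hat\Delta_i^k)_{0\le k\le K,\,1\le i\le n}$ and all iterates $x^0,\dots,x^{K+1}$. **Claim.** Let $R=\max_i\|\nabla f_i(x^0)-g_i^0\|>0$ and $\Delta=\sqrt{L_{\max}(\alpha+R)(f(x^0)-f^{\inf})/R}$. For every $\kappa>0$ there is $c_0>0$, depending only on $\kappa$, such that for all $C\ge c_0$ and $\theta>0$ there is $M>0$, depending only on $\kappa,C,\theta$, with the following property. Let $\epsilon>0$ and $0<\delta<1$ with $\epsilon\le\kappa\log(1/\delta)$, let $$c_0\,\frac{\sqrt{(K+1)\log(1/\delta)}}{\epsilon}\le\sigma_{\rm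 DP}\le C\,\frac{\sqrt{(K+1)\log(1/\delta)}}{\epsilon},$$ let $\beta=\beta_0/(K+1)$ with $0<\beta_0<\alpha$, and let $$\theta\,\bar\beta\le\beta_0\le\bar\beta:=\Delta\sqrt[4]{\frac{n\epsilon^2}{d\log(1/\delta)}},\qquad \theta\,\bar\gamma\le\gamma\le\bar\gamma:=\frac{\beta R}{\alpha+R}\,\frac1{L_{\max}},\qquad\gamma>0 .$$ Then the algorithm is $(\epsilon,\delta)$-differentially private, the expectations below are finite, and $$\min_{0\le k\le K}\mathbb E\|\nabla f(x^k)\|\le M\,\Delta\sqrt[4]{\frac{d\log(1/\delta)}{n\epsilon^2}}+2R .$$ -/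

import Mathlib

open MeasureTheory ProbabilityTheory
open scoped Gradient

noncomputable section

namespace NormEC

/-- The parameter space `ℝᵈ` with the Euclidean norm. -/
abbrev E (d : ℕ) := EuclideanSpace ℝ (Fin d)

/-- The finite-sum objective `f(x) = (1/n) ∑ᵢ fᵢ(x)`. -/
def avg {n d : ℕ} (f : Fin n → E d → ℝ) (x : E d) : ℝ :=
  (1 / (n : ℝ)) * ∑ i, f i x

/-- `f` is `L`-smooth: differentiable with `L`-Lipschitz gradient. -/
def IsSmooth {d : ℕ} (f : E d → ℝ) (L : ℝ) : Prop :=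
  Differentiable ℝ f ∧ ∀ x y : E d, ‖∇ f x - ∇ f y‖ ≤ L * ‖x - y‖

/-- Smoothed normalization `g ↦ g / (α + ‖g‖)`. -/
def smoothedNormalize {d : ℕ} (α : ℝ) (g : E d) : E d :=
  (1 / (α + ‖g‖)) • g

/-- The inputs of the algorithm: step size `γ`, parameter `β`, normalization parameter `α`,
the starting point `x⁰` and the initial memory vectors `gᵢ⁰`. -/
structure Params (n d : ℕ) where
  γ : ℝ
  β : ℝ
  α : ℝ
  x₀ : E d
  g₀ : Fin n → E d

/-- The variables of the algorithm: the iterate `x`, the memory vector `ĝ` of the server and the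
memory vectors `gᵢ` of the clients. -/
structure State (n d : ℕ) where
  x : E d
  ghat : E d
  g : Fin n → E d

/-- The initial state, with `ĝ⁰ = (1/n) ∑ᵢ gᵢ⁰`. -/
def initState {n d : ℕ} (p : Params n d) : State n d where
  x := p.x₀
  ghat := (1 / (n : ℝ)) • ∑ i, p.g₀ i
  g := p.g₀

/-- The normalized update `Δᵢ = Norm_α(∇fᵢ(x) - gᵢ)` of client `i`. -/
def localUpdate {n d : ℕ} (f : Fin n → E d → ℝ) (p : Params n d) (s : State n d) (i : Fin n) :
    E d :=
  smoothedNormalize p.α (∇ (f i) s.x - s.g i)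

/-- The privatized message `Δ̂ᵢ = Δᵢ + zᵢ` that client `i` transmits to the server. -/
def message {n d : ℕ} (f : Fin n → E d → ℝ) (p : Params n d) (z : Fin n → E d) (s : State n d)
    (i : Fin n) : E d :=
  localUpdate f p s i + z i

/-- The server's update `ĝ ↦ ĝ + (β/n) ∑ᵢ Δ̂ᵢ`. -/
def serverMemory {n d : ℕ} (f : Fin n → E d → ℝ) (p : Params n d) (z : Fin n → E d)
    (s : State n d) : E d :=
  s.ghat + (p.β / (n : ℝ)) • ∑ i, message f p z s i

/-- One iteration of DP-`α`-NormEC with noise vectors `z₁, …, zₙ`; the server-normalized step uses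
the convention `0/0 = 0`. -/
def step {n d : ℕ} (f : Fin n → E d → ℝ) (p : Params n d) (z : Fin n → E d) (s : State n d) :
    State n d where
  x := s.x - p.γ • (‖serverMemory f p z s‖⁻¹ • serverMemory f p z s)
  ghat := serverMemory f p z s
  g := fun i => s.g i + p.β • localUpdate f p s i

/-- The noise vectors `zᵢᵏ`, `k ∈ {0, …, K}`, `i ∈ {1, …, n}`, of one run. -/
abbrev Noise (n d K : ℕ) := Fin (K + 1) → Fin n → E d

/-- The state at the beginning of iteration `k`, for `0 ≤ k ≤ K + 1`. (The value for `k > K + 1`,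
where the run is over, is never used.) -/
def state {n d K : ℕ} (f : Fin n → E d → ℝ) (p : Params n d) (z : Noise n d K) : ℕ → State n d
  | 0 => initState p
  | k + 1 => step f p (if h : k < K + 1 then z ⟨k, h⟩ else 0) (state f p z k)

/-- The iterate `xᵏ`. -/
def iterate {n d K : ℕ} (f : Fin n → E d → ℝ) (p : Params n d) (z : Noise n d K) (k : ℕ) : E d :=
  (state f p z k).x

/-- The Gaussian law `N(0, σ² I_d)` on `ℝᵈ`. -/
def gaussianNoise (d : ℕ) (σ : ℝ) : Measure (E d) :=
  (stdGaussian (E d)).map (fun v => σ • v)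

/-- The joint law of the noise vectors: all `zᵢᵏ` are independent with law `N(0, σ² I_d)`. -/
def noiseLaw (n d K : ℕ) (σ : ℝ) : Measure (Noise n d K) :=
  Measure.pi fun _ => Measure.pi fun _ => gaussianNoise d σ

/-- Everything that a run reveals: all the messages `Δ̂ᵢᵏ`, `0 ≤ k ≤ K`, sent to the server, and all
the iterates `x⁰, …, x^{K+1}`; the last of these is the output of the algorithm. -/
abbrev Release (n d K : ℕ) := (Fin (K + 1) → Fin n → E d) × (Fin (K + 2) → E d)

/-- What the run with noise `z` on the loss functions `f` reveals. -/
def release {n d K : ℕ} (f : Fin n → E d → ℝ) (p : Params n d) (z : Noise n d K) :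
    Release n d K :=
  (fun k i => message f p (z k) (state f p z k) i, fun k => iterate f p z k)

/-- DP-`α`-NormEC as a randomized mechanism: the law of what a run on `f` reveals. -/
def mechanism {n d : ℕ} (K : ℕ) (σ : ℝ) (p : Params n d) (f : Fin n → E d → ℝ) :
    Measure (Release n d K) :=
  (noiseLaw n d K σ).map (release f p)

/-- Two tuples of differentiable loss functions are neighbouring if they differ in at most one
client's loss function. -/
def Neighbouring {n d : ℕ} (f f' : Fin n → E d → ℝ) : Prop :=
  (∀ i, Differentiable ℝ (f i)) ∧ (∀ i, Differentiable ℝ (f' i)) ∧ ∃ j, ∀ i, i ≠ j → f i = f' i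

/-- `(ε, δ)`-differential privacy of a randomized mechanism `M`, given by the law `M D` of its
output on each dataset `D`, with respect to the neighbouring relation `adj`. -/
def IsDifferentiallyPrivate {D Out : Type*} [MeasurableSpace Out] (adj : D → D → Prop)
    (M : D → Measure Out) (ε δ : ℝ) : Prop :=
  ∀ D₁ D₂ : D, adj D₁ D₂ →
    IsProbabilityMeasure (M D₁) ∧ IsProbabilityMeasure (M D₂) ∧
      ∀ S : Set Out, MeasurableSet S →
        M D₁ S ≤ ENNReal.ofReal (Real.exp ε) * M D₂ S + ENNReal.ofReal δ

/-- `R = maxᵢ ‖∇fᵢ(x⁰) - gᵢ⁰‖`. -/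
def initError {n d : ℕ} (f : Fin n → E d → ℝ) (p : Params n d) : ℝ :=
  ⨆ i, ‖∇ (f i) p.x₀ - p.g₀ i‖

/-- `L_max = maxᵢ Lᵢ`. -/
def maxSmoothness {n : ℕ} (L : Fin n → ℝ) : ℝ :=
  ⨆ i, L i

/-- `Δ = √(L_max (α + R) (f(x⁰) - f^inf) / R)`. -/
def Delta {n d : ℕ} (f : Fin n → E d → ℝ) (p : Params n d) (L : Fin n → ℝ) (finf : ℝ) : ℝ :=
  Real.sqrt (maxSmoothness L * (p.α + initError f p) * (avg f p.x₀ - finf) / initError f p)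

end NormEC

end

/-!
The theorem has two independent halves.

*Privacy.* Fix neighbouring tuples `f`, `f'` and couple the two runs so that they reveal the same
things: if the run on `f` uses the noise `z`, the run on `f'` has to use `z + v(z)`, where
`v(z)` (`updateGap`) is the difference of the noiseless updates of the two runs along this common
trajectory. The iterates and the memory of the server are functions of the messages alone, so only
the client whose loss was replaced contributes to `v`, and `∑ᵢ ‖vᵢᵏ‖² ≤ 2² = 4` because a smoothed
normalization has norm at most one. The shift is *predictable*: `vᵏ` depends only on the noise of
the rounds before `k`. Integrating out one round at a time gives a discrete Girsanov formula
(`IsShiftDensity.lintegral_predictable`), `𝔼 [F(z + v) exp(-ℓ(z))] = 𝔼 [F(z)]`, whose exponent `ℓ`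
is the privacy loss. Applied to the shift `-t • v` and `F = 1`, the same formula bounds the
exponential moment `𝔼 exp(t ℓ)`, hence by Markov's inequality the probability that `ℓ ≥ ε`. Where
`ℓ ≤ ε`, the density is at least `exp(-ε)`, and differential privacy follows
(`noiseLaw_preimage_shift_le`). The choice `t = 2 log(1/δ) / ε` gives the constant
`c₀ = 2 √(κ + 2)`.

*Utility.* Since `x ↦ x - β x / (α + x)` is increasing for `β ≤ α`, one update of the memory of
client `i` shrinks an error of at most `R` to at most `R - βR/(α + R)`, and the bound on `γ` makes
the following move of the iterate restore at most `βR/(α + R)`. So the error never exceeds `R`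
(`norm_gradient_sub_memory_le`). The server's vector differs from the mean of the clients' memory
vectors by `β/n` times the accumulated noise, and the descent inequality for a normalized step
telescopes along each path (`sum_norm_gradient_le`). The accumulated noise has second moment at
most `(K + 1) n d σ²`, and the rest is the choice of the parameters.
-/

open MeasureTheory ProbabilityTheory
open scoped Gradient

noncomputable section

namespace NormEC

open scoped ENNReal

/-! ### Undoing a translation of a product measure -/

/-- `ρ` undoes the translations of `μ`: weighting `μ` by `ρ · v` and then translating by `v` gives
back `μ`. If `μ` has a positive density `q` with respect to a translation invariant measure, this
holds for `ρ z v = q (z + v) / q z`. The second argument is the translation vector, and the weight is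
a function of the point before the translation. -/
def IsShiftDensity {X : Type*} [MeasurableSpace X] [Add X] (μ : Measure X)
    (ρ : X → X → ℝ≥0∞) : Prop :=
  Measurable (Function.uncurry ρ) ∧ ∀ (v : X) (F : X → ℝ≥0∞), Measurable F →
    ∫⁻ z, F (z + v) * ρ z v ∂μ = ∫⁻ z, F z ∂μ

/-- Tonelli's theorem for the last coordinate of a finite power, integrated first. -/
theorem lintegral_pi_snoc {X : Type*} [MeasurableSpace X] (μ : Measure X) [SigmaFinite μ] {N : ℕ}
    {F : (Fin (N + 1) → X) → ℝ≥0∞} (hF : Measurable F) :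
    ∫⁻ z, F z ∂(Measure.pi fun _ => μ) =
      ∫⁻ z, ∫⁻ y, F (Fin.snoc z y) ∂μ ∂(Measure.pi fun _ : Fin N => μ) := by
  have h := (measurePreserving_piFinSuccAbove (fun _ : Fin (N + 1) => μ) (Fin.last N)).symm
  rw [← h.lintegral_comp hF, lintegral_prod_symm]
  · simp [MeasurableEquiv.piFinSuccAbove, Fin.insertNthEquiv]
  · exact (hF.comp (MeasurableEquiv.measurable _)).aemeasurable

theorem measurable_snoc {X Y : Type*} [MeasurableSpace X] [MeasurableSpace Y] {N : ℕ}
    {a : Y → Fin N → X} {b : Y → X} (ha : Measurable a) (hb : Measurable b) :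
    Measurable fun y => (Fin.snoc (a y) (b y) : Fin (N + 1) → X) := by
  refine measurable_pi_iff.2 fun i => ?_
  refine Fin.lastCases ?_ (fun i => ?_) i
  · simpa using hb
  · simpa using measurable_pi_iff.1 ha i

/-- **Discrete Girsanov formula.** The translation of the `k`-th coordinate may depend on the
coordinates before `k`. The proof integrates out the last coordinate first: given the others, its
translation is constant. -/
theorem IsShiftDensity.lintegral_predictable {X : Type*} [MeasurableSpace X] [Add X]
    [MeasurableAdd₂ X] {μ : Measure X} [SigmaFinite μ] {ρ : X → X → ℝ≥0∞}
    (h : IsShiftDensity μ ρ) {N : ℕ} (v : Fin N → (Fin N → X) → X) (hv : ∀ k, Measurable (v k))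
    (hpred : ∀ k z w, (∀ l < k, z l = w l) → v k z = v k w)
    {F : (Fin N → X) → ℝ≥0∞} (hF : Measurable F) :
    ∫⁻ z, F (fun k => z k + v k z) * ∏ k, ρ (z k) (v k z) ∂(Measure.pi fun _ => μ) =
      ∫⁻ z, F z ∂(Measure.pi fun _ => μ) := by
  induction N with
  | zero =>
    refine lintegral_congr fun z => ?_
    simp [Subsingleton.elim (fun k => z k + v k z) z]
  | succ N ih =>
    have hρ : Measurable fun q : X × X => ρ q.1 q.2 := h.1
    have hm : Measurable fun z : Fin (N + 1) → X =>
        F (fun k => z k + v k z) * ∏ k, ρ (z k) (v k z) := by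
      refine (hF.comp (measurable_pi_iff.2 fun k => (measurable_pi_apply k).add (hv k))).mul ?_
      exact Finset.measurable_prod _ fun k _ =>
        hρ.comp ((measurable_pi_apply k).prodMk (hv k))
    rw [lintegral_pi_snoc μ hm, lintegral_pi_snoc μ hF]
    rcases isEmpty_or_nonempty X with hX | ⟨⟨x₀⟩⟩
    · simp [Measure.eq_zero_of_isEmpty μ]
    -- by predictability the last coordinate of the argument of `v` may be replaced by any point
    set w : Fin N → (Fin N → X) → X := fun k z => v k.castSucc (Fin.snoc z x₀) with hw
    set wl : (Fin N → X) → X := fun z => v (Fin.last N) (Fin.snoc z x₀) with hwl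
    have hsn : Measurable fun z : Fin N → X => (Fin.snoc z x₀ : Fin (N + 1) → X) :=
      measurable_snoc measurable_id measurable_const
    have hwm : ∀ k, Measurable (w k) := fun k => (hv _).comp hsn
    have hw' : ∀ k z y, v (Fin.castSucc k) (Fin.snoc z y) = w k z := by
      refine fun k z y => hpred _ _ _ fun l hl => ?_
      obtain ⟨l, rfl⟩ := Fin.exists_castSucc_eq.2 (ne_of_lt (hl.trans (Fin.castSucc_lt_last k)))
      simp
    have hwl' : ∀ z y, v (Fin.last N) (Fin.snoc z y) = wl z := by
      refine fun z y => hpred _ _ _ fun l hl => ?_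
      obtain ⟨l, rfl⟩ := Fin.exists_castSucc_eq.2 (ne_of_lt hl)
      simp
    have hG : Measurable fun z : Fin N → X => ∫⁻ y, F (Fin.snoc z y) ∂μ :=
      (hF.comp (measurable_snoc measurable_fst measurable_snd)).lintegral_prod_right'
    rw [← ih w hwm (fun k z z' hz => hpred _ _ _ fun l hl => ?_) hG]
    · refine lintegral_congr fun z => ?_
      have hT : ∀ y, (fun k => (Fin.snoc z y : Fin (N + 1) → X) k + v k (Fin.snoc z y)) =
          Fin.snoc (fun k => z k + w k z) (y + wl z) := by
        intro y
        ext k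
        refine Fin.lastCases ?_ (fun k => ?_) k
        · simp [hwl']
        · simp [hw']
      simp_rw [hT, Fin.prod_univ_castSucc, Fin.snoc_castSucc, Fin.snoc_last, hw', hwl']
      rw [← h.2 (wl z) (fun y => F (Fin.snoc (fun k => z k + w k z) y))
        (hF.comp (measurable_snoc measurable_const measurable_id)), ← lintegral_mul_const]
      · refine lintegral_congr fun y => ?_
        ring
      · refine (hF.comp (measurable_snoc measurable_const (measurable_add_const _))).mul ?_
        exact hρ.comp (measurable_id.prodMk measurable_const)
    · obtain ⟨l, rfl⟩ := Fin.exists_castSucc_eq.2 (ne_of_lt (hl.trans (Fin.castSucc_lt_last k)))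
      simpa using hz l (by simpa using hl)

theorem IsShiftDensity.pi {X : Type*} [MeasurableSpace X] [Add X]
    [MeasurableAdd₂ X] {μ : Measure X} [SigmaFinite μ] {ρ : X → X → ℝ≥0∞}
    (h : IsShiftDensity μ ρ) (N : ℕ) :
    IsShiftDensity (Measure.pi fun _ : Fin N => μ) (fun z v => ∏ i, ρ (z i) (v i)) := by
  refine ⟨Finset.measurable_prod _ fun i _ => ?_, fun v F hF => ?_⟩
  · exact h.1.comp (((measurable_pi_apply i).comp measurable_fst).prodMk
      ((measurable_pi_apply i).comp measurable_snd) :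
        Measurable fun q : (Fin N → X) × (Fin N → X) => (q.1 i, q.2 i))
  · exact h.lintegral_predictable (fun k _ => v k) (fun _ => measurable_const)
      (fun _ _ _ _ => rfl) hF

/-- Transport along `φ`, which turns the translation by `ψ v` into the translation by `v`. -/
theorem IsShiftDensity.map {X Y : Type*} [MeasurableSpace X] [Add X] [MeasurableSpace Y] [Add Y]
    [MeasurableAdd Y]
    {μ : Measure X} {ρ : X → X → ℝ≥0∞} {ρ' : Y → Y → ℝ≥0∞} (h : IsShiftDensity μ ρ)
    {φ : X → Y} {ψ : Y → X} (hφ : Measurable φ)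
    (hadd : ∀ x v, φ x + v = φ (x + ψ v)) (hρ : ∀ x v, ρ' (φ x) v = ρ x (ψ v))
    (hρ' : Measurable (Function.uncurry ρ')) :
    IsShiftDensity (μ.map φ) ρ' := by
  refine ⟨hρ', fun v F hF => ?_⟩
  rw [lintegral_map _ hφ, lintegral_map hF hφ, ← h.2 (ψ v) (fun x => F (φ x)) (hF.comp hφ)]
  · simp [hadd, hρ]
  · exact (hF.comp (measurable_add_const v)).mul (hρ'.comp measurable_prodMk_right)

theorem isShiftDensity_gaussianReal :
    IsShiftDensity (gaussianReal 0 1)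
      (fun z v => ENNReal.ofReal (Real.exp (-(z * v + v ^ 2 / 2)))) := by
  refine ⟨by simp only [Function.uncurry_def]; fun_prop, fun v F hF => ?_⟩
  have h1 : (1 : NNReal) ≠ 0 := one_ne_zero
  have hm := measurable_gaussianPDF 0 1
  rw [gaussianReal_of_var_ne_zero _ h1, lintegral_withDensity_eq_lintegral_mul _ hm hF,
    lintegral_withDensity_eq_lintegral_mul _ hm (by fun_prop),
    ← lintegral_add_right_eq_self (gaussianPDF 0 1 * F) v]
  refine lintegral_congr fun z => ?_
  simp only [Pi.mul_apply]
  have : gaussianPDF 0 1 (z + v) =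
      gaussianPDF 0 1 z * ENNReal.ofReal (Real.exp (-(z * v + v ^ 2 / 2))) := by
    rw [gaussianPDF, gaussianPDF, ← ENNReal.ofReal_mul (gaussianPDFReal_nonneg _ _ _),
      gaussianPDFReal, gaussianPDFReal, mul_assoc _ (Real.exp _) (Real.exp _), ← Real.exp_add]
    congr 3
    simp
    ring
  rw [this]
  ring

theorem gaussianNoise_eq_map_pi (d : ℕ) (σ : ℝ) :
    gaussianNoise d σ = (Measure.pi fun _ : Fin d => gaussianReal 0 1).map
      (fun x => σ • WithLp.toLp 2 x) := by
  rw [gaussianNoise, ← map_pi_eq_stdGaussian, Measure.map_map (by fun_prop) (by fun_prop)]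
  rfl

/-- The density that undoes a translation by `v` of `N(0, σ² I_d)`, at the point `z`. -/
def shiftWeight (d : ℕ) (σ : ℝ) (z v : E d) : ℝ≥0∞ :=
  ENNReal.ofReal (Real.exp (-((inner ℝ z v + ‖v‖ ^ 2 / 2) / σ ^ 2)))

/-- **Cameron–Martin formula** for `N(0, σ² I_d)`. -/
theorem isShiftDensity_gaussianNoise (d : ℕ) {σ : ℝ} (hσ : σ ≠ 0) :
    IsShiftDensity (gaussianNoise d σ) (shiftWeight d σ) := by
  rw [gaussianNoise_eq_map_pi]
  refine (isShiftDensity_gaussianReal.pi d).map (ψ := fun v => σ⁻¹ • v.ofLp) (by fun_prop)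
    (fun x v => ?_) (fun x v => ?_) ?_
  · ext i
    simp [hσ]
  · rw [shiftWeight, ← ENNReal.ofReal_prod_of_nonneg (fun _ _ => (Real.exp_pos _).le),
      ← Real.exp_sum]
    congr 2
    rw [EuclideanSpace.real_norm_sq_eq]
    simp only [PiLp.inner_apply, PiLp.smul_apply, Finset.sum_neg_distrib, Finset.sum_div,
      ← Finset.sum_add_distrib]
    congr 1
    refine Finset.sum_congr rfl fun i _ => ?_
    simp
    field_simp
  · simp only [Function.uncurry_def, shiftWeight]
    fun_prop

/-! ### Tail bounds for the privacy loss -/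

instance isProbabilityMeasure_gaussianNoise (d : ℕ) (σ : ℝ) :
    IsProbabilityMeasure (gaussianNoise d σ) :=
  Measure.isProbabilityMeasure_map (by fun_prop)

instance isProbabilityMeasure_noiseLaw (n d K : ℕ) (σ : ℝ) :
    IsProbabilityMeasure (noiseLaw n d K σ) := by
  unfold noiseLaw; infer_instance

/-- The logarithm of the ratio of the Gaussian densities of the noise at `z` and at the shifted noise
`z + v(z)`. For the shift that couples two runs, this is the log-likelihood ratio of the released
messages. -/
def privacyLoss {n d K : ℕ} (σ : ℝ) (v : Fin (K + 1) → Noise n d K → Fin n → E d)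
    (z : Noise n d K) : ℝ :=
  ∑ k, ∑ i, (inner ℝ (z k i) (v k z i) + ‖v k z i‖ ^ 2 / 2) / σ ^ 2

section Shift

variable {n d K : ℕ} {σ : ℝ} {v : Fin (K + 1) → Noise n d K → Fin n → E d}

theorem measurable_privacyLoss (hv : ∀ k, Measurable (v k)) : Measurable (privacyLoss σ v) := by
  have : ∀ k i, Measurable fun z => v k z i := fun k i => measurable_pi_iff.1 (hv k) i
  unfold privacyLoss
  fun_prop

/-- The Girsanov formula for the noise of a whole run. -/
theorem lintegral_shift_mul_exp_neg_privacyLoss (hσ : σ ≠ 0) (hv : ∀ k, Measurable (v k))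
    (hpred : ∀ k z w, (∀ l < k, z l = w l) → v k z = v k w)
    {F : Noise n d K → ℝ≥0∞} (hF : Measurable F) :
    ∫⁻ z, F (fun k => z k + v k z) * ENNReal.ofReal (Real.exp (-privacyLoss σ v z))
        ∂(noiseLaw n d K σ) = ∫⁻ z, F z ∂(noiseLaw n d K σ) := by
  rw [noiseLaw, ← ((isShiftDensity_gaussianNoise d hσ).pi n).lintegral_predictable v hv hpred hF]
  refine lintegral_congr fun z => ?_
  simp_rw [shiftWeight, ← ENNReal.ofReal_prod_of_nonneg (fun _ _ => (Real.exp_pos _).le),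
    ← Real.exp_sum]
  rw [← ENNReal.ofReal_prod_of_nonneg (fun _ _ => (Real.exp_pos _).le), ← Real.exp_sum]
  simp only [privacyLoss, Finset.sum_neg_distrib]

/-- Chernoff bound for the privacy loss of a predictable shift of size at most `√s` in each
round. -/
theorem measure_privacyLoss_ge_le (hσ : σ ≠ 0) (hv : ∀ k, Measurable (v k))
    (hpred : ∀ k z w, (∀ l < k, z l = w l) → v k z = v k w) {s : ℝ}
    (hs : ∀ k z, ∑ i, ‖v k z i‖ ^ 2 ≤ s) {t : ℝ} (ht : 0 ≤ t) (ε : ℝ) :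
    noiseLaw n d K σ {z | ε ≤ privacyLoss σ v z} ≤
      ENNReal.ofReal (Real.exp (t * (t + 1) * ((K + 1) * s / (2 * σ ^ 2)) - t * ε)) := by
  -- The Girsanov formula for the shift `-t • v` says that `exp (-ℓ')` has mean one, where `ℓ'` is the
  -- privacy loss of that shift; up to the squared norms of `v`, `-ℓ'` is `t` times that of `v`.
  have key := lintegral_shift_mul_exp_neg_privacyLoss (v := fun k z => -t • v k z) hσ
    (fun k => (hv k).fun_const_smul _) (fun k z w h => by simp only [hpred k z w h])
    (F := fun _ => 1) measurable_const
  simp only [one_mul, lintegral_const, measure_univ] at key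
  have hσ2 : 0 < σ ^ 2 := by positivity
  have hle : ∀ z ∈ {z | ε ≤ privacyLoss σ v z},
      t * ε - t * (t + 1) * ((K + 1) * s / (2 * σ ^ 2)) ≤
        -privacyLoss σ (fun k z => -t • v k z) z := by
    intro z hz
    have e : -privacyLoss σ (fun k z => -t • v k z) z = t * privacyLoss σ v z -
        t * (t + 1) * (∑ k, ∑ i, ‖v k z i‖ ^ 2) / (2 * σ ^ 2) := by
      simp only [privacyLoss, Finset.mul_sum, Finset.sum_div, ← Finset.sum_neg_distrib,
        ← Finset.sum_sub_distrib, Pi.smul_apply, norm_smul, inner_smul_right, norm_neg,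
        Real.norm_eq_abs, mul_pow, sq_abs]
      refine Finset.sum_congr rfl fun k _ => Finset.sum_congr rfl fun i _ => ?_
      field_simp
      ring
    have h1 : ∑ k, ∑ i, ‖v k z i‖ ^ 2 ≤ (K + 1) * s := by
      refine (Finset.sum_le_sum fun k _ => hs k z).trans ?_
      simp
    have h2 : t * (t + 1) * (∑ k, ∑ i, ‖v k z i‖ ^ 2) / (2 * σ ^ 2) ≤
        t * (t + 1) * ((K + 1) * s / (2 * σ ^ 2)) := by
      rw [mul_div_assoc]
      gcongr
    rw [e]
    exact sub_le_sub (mul_le_mul_of_nonneg_left hz ht) h2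
  set a : ℝ := t * ε - t * (t + 1) * ((K + 1) * s / (2 * σ ^ 2)) with ha
  have hmarkov : ENNReal.ofReal (Real.exp a) * noiseLaw n d K σ {z | ε ≤ privacyLoss σ v z} ≤
      1 := by
    rw [← key]
    refine le_trans ?_ (mul_meas_ge_le_lintegral
      (μ := noiseLaw n d K σ) (ENNReal.measurable_ofReal.comp
      (Real.measurable_exp.comp (measurable_privacyLoss (σ := σ)
        fun k => (hv k).fun_const_smul (-t)).neg)) (ENNReal.ofReal (Real.exp a)))
    refine mul_le_mul' le_rfl (measure_mono fun z hz => ?_)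
    exact ENNReal.ofReal_le_ofReal (Real.exp_le_exp.2 (hle z hz))
  rw [show t * (t + 1) * ((K + 1) * s / (2 * σ ^ 2)) - t * ε = -a by rw [ha]; ring, Real.exp_neg,
    ENNReal.ofReal_inv_of_pos (Real.exp_pos _)]
  rw [mul_comm] at hmarkov
  exact (ENNReal.le_inv_iff_mul_le).2 hmarkov

/-- A predictable shift of the noise is indistinguishable from no shift, with `δ` given by the
Chernoff bound. -/
theorem noiseLaw_preimage_shift_le (hσ : σ ≠ 0) (hv : ∀ k, Measurable (v k))
    (hpred : ∀ k z w, (∀ l < k, z l = w l) → v k z = v k w) {s : ℝ}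
    (hs : ∀ k z, ∑ i, ‖v k z i‖ ^ 2 ≤ s) {t : ℝ} (ht : 0 ≤ t) (ε : ℝ)
    {A : Set (Noise n d K)} (hA : MeasurableSet A) :
    noiseLaw n d K σ ((fun z k => z k + v k z) ⁻¹' A) ≤
      ENNReal.ofReal (Real.exp ε) * noiseLaw n d K σ A +
      ENNReal.ofReal (Real.exp (t * (t + 1) * ((K + 1) * s / (2 * σ ^ 2)) - t * ε)) := by
  set T : Noise n d K → Noise n d K := fun z k => z k + v k z
  have hT : Measurable T := measurable_pi_iff.2 fun k => (measurable_pi_apply k).add (hv k)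
  have hsub : T ⁻¹' A ⊆ (T ⁻¹' A ∩ {z | privacyLoss σ v z ≤ ε}) ∪
      {z | ε ≤ privacyLoss σ v z} := by
    intro z hz
    rcases le_total (privacyLoss σ v z) ε with h | h
    · exact Or.inl ⟨hz, h⟩
    · exact Or.inr h
  have hB : MeasurableSet (T ⁻¹' A ∩ {z | privacyLoss σ v z ≤ ε}) :=
    (hT hA).inter (measurableSet_le (measurable_privacyLoss hv) measurable_const)
  refine (measure_mono hsub).trans ((measure_union_le _ _).trans
    (add_le_add ?_ (measure_privacyLoss_ge_le hσ hv hpred hs ht ε)))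
  have hind : Measurable (A.indicator (1 : Noise n d K → ℝ≥0∞)) := measurable_one.indicator hA
  rw [← lintegral_indicator_one hB, ← lintegral_indicator_one hA,
    ← lintegral_shift_mul_exp_neg_privacyLoss hσ hv hpred hind, ← lintegral_const_mul]
  · refine lintegral_mono fun z => ?_
    by_cases hz : z ∈ T ⁻¹' A ∩ {z | privacyLoss σ v z ≤ ε}
    · have hzA : (fun k => z k + v k z) ∈ A := hz.1
      have hle : privacyLoss σ v z ≤ ε := hz.2
      rw [Set.indicator_of_mem hz, Set.indicator_of_mem hzA, Pi.one_apply, Pi.one_apply, one_mul,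
        ← ENNReal.ofReal_mul (Real.exp_pos _).le, ← Real.exp_add, ENNReal.one_le_ofReal]
      exact Real.one_le_exp (by linarith)
    · rw [Set.indicator_of_notMem hz]
      exact zero_le
  · exact (hind.comp hT).mul (ENNReal.measurable_ofReal.comp
      (Real.measurable_exp.comp (measurable_privacyLoss hv).neg))

end Shift

/-! ### Coupling the runs on neighbouring tuples -/

section Coupling

variable {n d K : ℕ}

theorem measurable_gradient {d : ℕ} (f : E d → ℝ) : Measurable (∇ f) :=
  (InnerProductSpace.toDual ℝ (E d)).symm.continuous.measurable.comp (measurable_fderiv ℝ f)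

theorem measurable_smoothedNormalize (α : ℝ) :
    Measurable (smoothedNormalize α : E d → E d) := by
  unfold smoothedNormalize
  fun_prop

theorem norm_smoothedNormalize_le_one {α : ℝ} (hα : 0 < α) (g : E d) :
    ‖smoothedNormalize α g‖ ≤ 1 := by
  have h : 0 < α + ‖g‖ := by positivity
  rw [smoothedNormalize, norm_smul, Real.norm_of_nonneg (by positivity), one_div,
    inv_mul_le_one₀ h]
  linarith

theorem state_succ (f : Fin n → E d → ℝ) (p : Params n d) (z : Noise n d K) {k : ℕ}
    (hk : k < K + 1) : state f p z (k + 1) = step f p (z ⟨k, hk⟩) (state f p z k) := by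
  rw [state, dif_pos hk]

theorem state_congr (f : Fin n → E d → ℝ) (p : Params n d) {z w : Noise n d K} {k : ℕ}
    (h : ∀ l : Fin (K + 1), (l : ℕ) < k → z l = w l) : state f p z k = state f p w k := by
  induction k with
  | zero => rfl
  | succ k ih =>
    rw [state, state, ih fun l hl => h l (hl.trans k.lt_succ_self)]
    split_ifs with hk
    · rw [h ⟨k, hk⟩ k.lt_succ_self]
    · rfl

theorem measurable_state (f : Fin n → E d → ℝ) (p : Params n d) (k : ℕ) :
    (Measurable fun z : Noise n d K => (state f p z k).x) ∧
    (Measurable fun z : Noise n d K => (state f p z k).ghat) ∧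
    ∀ i, Measurable fun z : Noise n d K => (state f p z k).g i := by
  induction k with
  | zero => exact ⟨measurable_const, measurable_const, fun i => measurable_const⟩
  | succ k ih =>
    obtain ⟨hx, hh, hg⟩ := ih
    have hu : ∀ i, Measurable fun z : Noise n d K => localUpdate f p (state f p z k) i := fun i =>
      (measurable_smoothedNormalize p.α).comp (((measurable_gradient (f i)).comp hx).sub (hg i))
    have hz : ∀ i, Measurable fun z : Noise n d K =>
        (if h : k < K + 1 then z ⟨k, h⟩ else 0 : Fin n → E d) i := by
      intro i
      split_ifs with h
      · fun_prop
      · exact measurable_const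
    have hs : Measurable fun z : Noise n d K => (state f p z (k + 1)).ghat :=
      hh.add ((Finset.measurable_sum _ fun i _ => (hu i).fun_add (hz i)).fun_const_smul _)
    exact ⟨hx.sub ((hs.norm.inv.fun_smul hs).fun_const_smul _), hs,
      fun i => (hg i).add ((hu i).fun_const_smul _)⟩

theorem measurable_localUpdate_state (f : Fin n → E d → ℝ) (p : Params n d) (k : ℕ) (i : Fin n) :
    Measurable fun z : Noise n d K => localUpdate f p (state f p z k) i :=
  (measurable_smoothedNormalize p.α).comp
    (((measurable_gradient (f i)).comp (measurable_state f p k).1).sub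
      ((measurable_state f p k).2.2 i))

theorem measurable_release (f : Fin n → E d → ℝ) (p : Params n d) :
    Measurable (release f p : Noise n d K → Release n d K) := by
  refine Measurable.prodMk ?_ ?_
  · refine measurable_pi_iff.2 fun k => measurable_pi_iff.2 fun i => ?_
    exact (measurable_localUpdate_state f p k i).add (by fun_prop)
  · exact measurable_pi_iff.2 fun k => (measurable_state f p k).1

/-- The clients' memory vectors in the run on `f'` that reveals the same messages as the run on `f`
with noise `z`. It is defined along the iterates of the run on `f`, so that no noise of the second
run enters. -/
def twinMemory (f f' : Fin n → E d → ℝ) (p : Params n d) (z : Noise n d K) : ℕ → Fin n → E d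
  | 0 => p.g₀
  | k + 1 => fun i => twinMemory f f' p z k i +
      p.β • smoothedNormalize p.α (∇ (f' i) (state f p z k).x - twinMemory f f' p z k i)

/-- The state of the run on `f'` that reveals the same messages as the run on `f` with noise `z`: the
iterate and the memory of the server are shared. -/
def twinState (f f' : Fin n → E d → ℝ) (p : Params n d) (z : Noise n d K) (k : ℕ) : State n d where
  x := (state f p z k).x
  ghat := (state f p z k).ghat
  g := twinMemory f f' p z k

/-- The shift of the noise of round `k` that makes the run on `f'` reveal what the run on `f` with
noise `z` reveals. -/
def updateGap (f f' : Fin n → E d → ℝ) (p : Params n d) (k : Fin (K + 1)) (z : Noise n d K) :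
    Fin n → E d :=
  fun i => localUpdate f p (state f p z k) i - localUpdate f' p (twinState f f' p z k) i

theorem twinMemory_congr (f f' : Fin n → E d → ℝ) (p : Params n d) {z w : Noise n d K} {k : ℕ}
    (h : ∀ l : Fin (K + 1), (l : ℕ) < k → z l = w l) :
    twinMemory f f' p z k = twinMemory f f' p w k := by
  induction k with
  | zero => rfl
  | succ k ih =>
    have h' : ∀ l : Fin (K + 1), (l : ℕ) < k → z l = w l :=
      fun l hl => h l (hl.trans k.lt_succ_self)
    rw [twinMemory, twinMemory, ih h', state_congr f p h']

theorem updateGap_congr (f f' : Fin n → E d → ℝ) (p : Params n d) (k : Fin (K + 1))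
    (z w : Noise n d K) (h : ∀ l < k, z l = w l) : updateGap f f' p k z = updateGap f f' p k w := by
  have hl : ∀ l : Fin (K + 1), (l : ℕ) < k → z l = w l := h
  funext i
  rw [updateGap, updateGap, twinState, twinState, state_congr f p hl, twinMemory_congr f f' p hl]

theorem measurable_twinMemory (f f' : Fin n → E d → ℝ) (p : Params n d) (k : ℕ) (i : Fin n) :
    Measurable fun z : Noise n d K => twinMemory f f' p z k i := by
  induction k with
  | zero => exact measurable_const
  | succ k ih =>
    have hu : Measurable fun z : Noise n d K =>
        smoothedNormalize p.α (∇ (f' i) (state f p z k).x - twinMemory f f' p z k i) :=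
      (measurable_smoothedNormalize p.α).comp
        (((measurable_gradient (f' i)).comp (measurable_state f p k).1).sub ih)
    exact ih.add (hu.fun_const_smul _)

theorem measurable_updateGap (f f' : Fin n → E d → ℝ) (p : Params n d) (k : Fin (K + 1)) :
    Measurable (updateGap f f' p k) :=
  measurable_pi_iff.2 fun i => (measurable_localUpdate_state f p k i).sub
    ((measurable_smoothedNormalize p.α).comp
      (((measurable_gradient (f' i)).comp (measurable_state f p k).1).sub
        (measurable_twinMemory f f' p k i)))

/-- A client whose loss function is not replaced has the same memory in both runs. -/
theorem twinMemory_eq (f f' : Fin n → E d → ℝ) (p : Params n d) (z : Noise n d K) {k : ℕ}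
    (hk : k ≤ K + 1) {i : Fin n} (hi : f i = f' i) :
    twinMemory f f' p z k i = (state f p z k).g i := by
  induction k with
  | zero => rfl
  | succ k ih =>
    rw [state_succ f p z hk]
    simp only [twinMemory, ih (Nat.le_of_succ_le hk), ← hi]
    rfl

theorem sum_norm_updateGap_sq_le {f f' : Fin n → E d → ℝ} {p : Params n d} (hα : 0 < p.α)
    {j : Fin n} (hj : ∀ i, i ≠ j → f i = f' i) (k : Fin (K + 1)) (z : Noise n d K) :
    ∑ i, ‖updateGap f f' p k z i‖ ^ 2 ≤ 4 := by
  rw [Finset.sum_eq_single j]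
  · have h : ‖updateGap f f' p k z j‖ ≤ 1 + 1 :=
      (norm_sub_le _ _).trans (add_le_add (norm_smoothedNormalize_le_one hα _)
        (norm_smoothedNormalize_le_one hα _))
    nlinarith [norm_nonneg (updateGap f f' p k z j)]
  · intro i _ hi
    simp [updateGap, localUpdate, twinState, twinMemory_eq f f' p z k.2.le (hj i hi), hj i hi]
  · simp

theorem message_twinState (f f' : Fin n → E d → ℝ) (p : Params n d) (z : Noise n d K)
    (k : Fin (K + 1)) (i : Fin n) :
    message f' p (z k + updateGap f f' p k z) (twinState f f' p z k) i =
      message f p (z k) (state f p z k) i := by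
  simp only [message, updateGap, Pi.add_apply]
  abel

theorem state_shift (f f' : Fin n → E d → ℝ) (p : Params n d) (z : Noise n d K) {k : ℕ}
    (hk : k ≤ K + 1) :
    state f' p (fun k => z k + updateGap f f' p k z) k = twinState f f' p z k := by
  induction k with
  | zero => rfl
  | succ k ih =>
    have hs : serverMemory f' p (z ⟨k, hk⟩ + updateGap f f' p ⟨k, hk⟩ z) (twinState f f' p z k) =
        serverMemory f p (z ⟨k, hk⟩) (state f p z k) := by
      simp only [serverMemory, message_twinState f f' p z ⟨k, hk⟩]
      rfl
    rw [state_succ f' p _ hk, ih (Nat.le_of_succ_le hk), step, hs, twinState.eq_def f f' p z (k + 1),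
      state_succ f p z hk]
    rfl

theorem release_shift (f f' : Fin n → E d → ℝ) (p : Params n d) (z : Noise n d K) :
    release f' p (fun k => z k + updateGap f f' p k z) = release f p z := by
  refine Prod.ext ?_ ?_
  · ext1 k
    ext1 i
    simp only [release]
    rw [state_shift f f' p z k.2.le, message_twinState]
  · ext1 k
    simp only [release, iterate]
    rw [state_shift f f' p z (Nat.lt_succ_iff.1 k.2)]
    rfl

theorem isDifferentiallyPrivate_mechanism (p : Params n d) (hα : 0 < p.α) {σ : ℝ} (hσ : σ ≠ 0)
    {t ε δ : ℝ} (ht : 0 ≤ t)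
    (h : Real.exp (t * (t + 1) * ((K + 1) * 4 / (2 * σ ^ 2)) - t * ε) ≤ δ) :
    IsDifferentiallyPrivate Neighbouring (mechanism K σ p) ε δ := by
  rintro f f' ⟨-, -, j, hj⟩
  refine ⟨Measure.isProbabilityMeasure_map (measurable_release f p).aemeasurable,
    Measure.isProbabilityMeasure_map (measurable_release f' p).aemeasurable, fun S hS => ?_⟩
  rw [mechanism, mechanism, Measure.map_apply (measurable_release f p) hS,
    Measure.map_apply (measurable_release f' p) hS]
  have hpre : release f p ⁻¹' S =
      (fun z k => z k + updateGap f f' p k z) ⁻¹' (release f' p ⁻¹' S) := by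
    ext z
    simp only [Set.mem_preimage, release_shift]
  rw [hpre]
  refine (noiseLaw_preimage_shift_le hσ (measurable_updateGap f f' p) (updateGap_congr f f' p)
    (sum_norm_updateGap_sq_le hα hj) ht ε (measurable_release f' p hS)).trans ?_
  gcongr

/-- Privacy for a noise level above `2 √(κ + 2) √((K + 1) log(1/δ)) / ε`. -/
theorem isDifferentiallyPrivate_mechanism_of_le (p : Params n d) (hα : 0 < p.α) {κ σ ε δ : ℝ}
    (hκ : 0 < κ) (hε : 0 < ε) (hδ : 0 < δ) (hδ1 : δ < 1) (hεδ : ε ≤ κ * Real.log (1 / δ))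
    (hσ : 2 * √(κ + 2) * (√((K + 1 : ℝ) * Real.log (1 / δ)) / ε) ≤ σ) :
    IsDifferentiallyPrivate Neighbouring (mechanism K σ p) ε δ := by
  set l := Real.log (1 / δ) with hl
  have hl0 : 0 < l := Real.log_pos (by rw [lt_div_iff₀ hδ]; linarith)
  have hK : (0 : ℝ) < K + 1 := by positivity
  have hσ0 : 0 < σ := lt_of_lt_of_le (by positivity) hσ
  have hsq : 4 * (κ + 2) * ((K + 1) * l) ≤ σ ^ 2 * ε ^ 2 := by
    have h1 : (2 * √(κ + 2) * (√((K + 1 : ℝ) * l) / ε)) ^ 2 ≤ σ ^ 2 := by gcongr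
    rw [mul_pow, mul_pow, div_pow, Real.sq_sqrt (by positivity), Real.sq_sqrt (by positivity),
      ← mul_div_assoc, div_le_iff₀ (by positivity)] at h1
    linarith
  -- With this `t`, the factor `exp (-t ε)` is `δ²`, and the noise level makes the other factor at
  -- most `1 / δ`.
  refine isDifferentiallyPrivate_mechanism p hα hσ0.ne' (t := 2 * l / ε) (by positivity) ?_
  have hδl : δ = Real.exp (-l) := by
    rw [hl, one_div, Real.log_inv, neg_neg, Real.exp_log hδ]
  rw [hδl, Real.exp_le_exp]
  have h2 : 2 * l / ε * ε = 2 * l := by field_simp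
  have h3 : (2 * l / ε + 1) * ((K + 1) * 4 / (2 * σ ^ 2)) ≤ ε / 2 := by
    rw [div_add_one hε.ne', div_mul_div_comm, div_le_div_iff₀ (by positivity) (by norm_num)]
    have : (2 * l + ε) * ((K + 1) * 4) ≤ ((κ + 2) * l) * ((K + 1) * 4) := by
      gcongr
      linarith
    nlinarith
  have h4 : 2 * l / ε * ((2 * l / ε + 1) * ((K + 1) * 4 / (2 * σ ^ 2))) ≤ 2 * l / ε * (ε / 2) := by
    gcongr
  have h5 : 2 * l / ε * (ε / 2) = l := by field_simp
  rw [mul_assoc, h2]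
  linarith

end Coupling

/-! ### Smoothness and normalized gradient steps -/

section Smooth

variable {n d : ℕ}

theorem gradient_avg {f : Fin n → E d → ℝ} (hf : ∀ i, Differentiable ℝ (f i)) (x : E d) :
    ∇ (avg f) x = (1 / (n : ℝ)) • ∑ i, ∇ (f i) x := by
  have h : HasFDerivAt (avg f) ((1 / (n : ℝ)) • ∑ i, fderiv ℝ (f i) x) x :=
    (HasFDerivAt.fun_sum fun i _ => (hf i x).hasFDerivAt).const_mul _
  simp [gradient, h.fderiv]

theorem le_maxSmoothness (L : Fin n → ℝ) (i : Fin n) : L i ≤ maxSmoothness L :=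
  le_ciSup (Set.finite_range L).bddAbove i

theorem norm_smul_sum_le {n : ℕ} {F : Type*} [SeminormedAddCommGroup F] [NormedSpace ℝ F]
    {u : Fin n → F} {c : ℝ} (hn : 0 < n) (hu : ∀ i, ‖u i‖ ≤ c) :
    ‖(1 / (n : ℝ)) • ∑ i, u i‖ ≤ c := by
  have hn' : (0 : ℝ) < n := Nat.cast_pos.2 hn
  rw [norm_smul, Real.norm_of_nonneg (by positivity), one_div, inv_mul_le_iff₀ hn']
  refine (norm_sum_le _ _).trans ((Finset.sum_le_sum fun i _ => hu i).trans ?_)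
  simp

theorem isSmooth_avg {f : Fin n → E d → ℝ} {L : Fin n → ℝ} (hn : 0 < n)
    (hf : ∀ i, IsSmooth (f i) (L i)) : IsSmooth (avg f) (maxSmoothness L) := by
  refine ⟨(Differentiable.fun_sum fun i _ => (hf i).1).const_mul _, fun x y => ?_⟩
  rw [gradient_avg (fun i => (hf i).1), gradient_avg (fun i => (hf i).1), ← smul_sub,
    ← Finset.sum_sub_distrib]
  refine norm_smul_sum_le hn fun i => ((hf i).2 x y).trans ?_
  exact mul_le_mul_of_nonneg_right (le_maxSmoothness L i) (norm_nonneg _)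

/-- The descent lemma. -/
theorem IsSmooth.le_quadratic {f : E d → ℝ} {L : ℝ} (hf : IsSmooth f L) (x v : E d) :
    f (x + v) ≤ f x + inner ℝ (∇ f x) v + L / 2 * ‖v‖ ^ 2 := by
  set h : ℝ → ℝ := fun t => f (x + t • v) - t * inner ℝ (∇ f x) v - L / 2 * ‖v‖ ^ 2 * t ^ 2
  have hd : ∀ t, HasDerivAt h
      (inner ℝ (∇ f (x + t • v)) v - inner ℝ (∇ f x) v - L * ‖v‖ ^ 2 * t) t := by
    intro t
    have h1 : HasDerivAt (fun t : ℝ => x + t • v) v t := by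
      simpa using ((hasDerivAt_id t).smul_const v).const_add x
    have h2 := (hf.1 (x + t • v)).hasGradientAt.hasFDerivAt.comp_hasDerivAt t h1
    rw [InnerProductSpace.toDual_apply_apply] at h2
    have h3 := (h2.sub ((hasDerivAt_id t).mul_const (inner ℝ (∇ f x) v))).sub
      ((hasDerivAt_pow 2 t).const_mul (L / 2 * ‖v‖ ^ 2))
    refine h3.congr_deriv ?_
    norm_num
    ring
  have hanti : AntitoneOn h (Set.Icc 0 1) := by
    refine antitoneOn_of_deriv_nonpos (convex_Icc 0 1)
      (fun t _ => (hd t).continuousAt.continuousWithinAt)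
      (fun t _ => (hd t).differentiableAt.differentiableWithinAt) fun t ht => ?_
    rw [interior_Icc] at ht
    rw [(hd t).deriv, ← inner_sub_left]
    have h1 := hf.2 (x + t • v) x
    rw [add_sub_cancel_left, norm_smul, Real.norm_of_nonneg ht.1.le] at h1
    have h2 := real_inner_le_norm (∇ f (x + t • v) - ∇ f x) v
    have h3 := mul_le_mul_of_nonneg_right h1 (norm_nonneg v)
    nlinarith
  have h01 := hanti (Set.left_mem_Icc.2 zero_le_one) (Set.right_mem_Icc.2 zero_le_one) zero_le_one
  simp only [h, one_smul, zero_smul, add_zero] at h01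
  linarith

/-- Descent for a normalized step along `h`. For `h = 0` the step vanishes by the convention
`0/0 = 0`, and the inequality still holds because then `‖∇ f x‖ ≤ 2 ‖∇ f x - h‖`. -/
theorem IsSmooth.normalized_step_le {f : E d → ℝ} {L : ℝ} (hf : IsSmooth f L) (hL : 0 ≤ L)
    {γ : ℝ} (hγ : 0 ≤ γ) (x h : E d) :
    f (x - γ • (‖h‖⁻¹ • h)) ≤
      f x - γ * ‖∇ f x‖ + 2 * γ * ‖∇ f x - h‖ + L / 2 * γ ^ 2 := by
  have hu : ‖‖h‖⁻¹ • h‖ ≤ 1 := by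
    rw [norm_smul, norm_inv, norm_norm]
    exact inv_mul_le_one
  have hin : ‖∇ f x‖ - 2 * ‖∇ f x - h‖ ≤ inner ℝ (∇ f x) (‖h‖⁻¹ • h) := by
    have h1 : inner ℝ h (‖h‖⁻¹ • h) = ‖h‖ := by
      rw [inner_smul_right, real_inner_self_eq_norm_sq]
      rcases eq_or_ne ‖h‖ 0 with h0 | h0
      · simp [h0]
      · field_simp
    have h2 : -‖∇ f x - h‖ ≤ inner ℝ (∇ f x - h) (‖h‖⁻¹ • h) := by
      refine (abs_le.1 ((abs_real_inner_le_norm _ _).trans ?_)).1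
      exact mul_le_of_le_one_right (norm_nonneg _) hu
    have h3 : ‖∇ f x‖ - ‖∇ f x - h‖ ≤ ‖h‖ := by
      have := norm_sub_norm_le (∇ f x) (∇ f x - h)
      rw [sub_sub_cancel] at this
      linarith
    rw [inner_sub_left, h1] at h2
    linarith
  have h4 := hf.le_quadratic x (-(γ • (‖h‖⁻¹ • h)))
  rw [← sub_eq_add_neg, inner_neg_right, inner_smul_right, norm_neg, norm_smul,
    Real.norm_of_nonneg hγ] at h4
  have h5 : (γ * ‖‖h‖⁻¹ • h‖) ^ 2 ≤ γ ^ 2 := by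
    have : γ * ‖‖h‖⁻¹ • h‖ ≤ γ := mul_le_of_le_one_right hγ hu
    gcongr
  nlinarith [mul_le_mul_of_nonneg_left hin hγ, mul_le_mul_of_nonneg_left h5 hL]

/-- One memory update contracts the error, by at least as much as it contracts an error of norm
`R`. -/
theorem norm_sub_smoothedNormalize_le {α β R : ℝ} (hβα : β ≤ α) (hα : 0 < α)
    {e : E d} (he : ‖e‖ ≤ R) :
    ‖e - β • smoothedNormalize α e‖ ≤ R - β * R / (α + R) := by
  have he0 := norm_nonneg e
  have h1 : e - β • smoothedNormalize α e = (1 - β / (α + ‖e‖)) • e := by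
    rw [smoothedNormalize, sub_smul, one_smul, smul_smul, mul_one_div]
  have h2 : β / (α + ‖e‖) ≤ 1 := by
    rw [div_le_one (by positivity)]
    linarith
  have hR : 0 ≤ R := he0.trans he
  rw [h1, norm_smul, Real.norm_of_nonneg (by linarith)]
  have h3 : R - β * R / (α + R) - (1 - β / (α + ‖e‖)) * ‖e‖ =
      (R - ‖e‖) * ((α + R) * (α + ‖e‖) - β * α) / ((α + R) * (α + ‖e‖)) := by
    field_simp
    ring
  have h4 : 0 ≤ (R - ‖e‖) * ((α + R) * (α + ‖e‖) - β * α) / ((α + R) * (α + ‖e‖)) := by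
    refine div_nonneg (mul_nonneg (by linarith) ?_) (by positivity)
    nlinarith [mul_nonneg hR he0, mul_nonneg hα.le he0, mul_nonneg hα.le hR,
      mul_le_mul_of_nonneg_right hβα hα.le]
  linarith

end Smooth

/-! ### The error of the memory vectors and the descent along a run -/

section Run

variable {n d K : ℕ} {f : Fin n → E d → ℝ} {p : Params n d}

theorem norm_iterate_succ_sub_le (hγ : 0 ≤ p.γ) (z : Noise n d K) (k : ℕ) :
    ‖iterate f p z (k + 1) - iterate f p z k‖ ≤ p.γ := by
  rw [iterate, state, step, iterate, sub_sub_cancel_left, norm_neg, norm_smul,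
    Real.norm_of_nonneg hγ, norm_smul, norm_inv, norm_norm]
  exact mul_le_of_le_one_right hγ inv_mul_le_one

theorem norm_iterate_sub_le (hγ : 0 ≤ p.γ) (z : Noise n d K) (k : ℕ) :
    ‖iterate f p z k - p.x₀‖ ≤ k * p.γ := by
  induction k with
  | zero => simp [iterate, state, initState]
  | succ k ih =>
    have := norm_add_le (iterate f p z (k + 1) - iterate f p z k) (iterate f p z k - p.x₀)
    rw [sub_add_sub_cancel] at this
    push_cast
    linarith [norm_iterate_succ_sub_le (f := f) hγ z k]

/-- The errors of the clients' memory vectors never exceed the largest initial one, whatever the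
noise. -/
theorem norm_gradient_sub_memory_le {L : Fin n → ℝ} (hf : ∀ i, IsSmooth (f i) (L i))
    (hα : 0 < p.α) (hβα : p.β ≤ p.α) (hγ : 0 ≤ p.γ) (hL : 0 ≤ maxSmoothness L)
    (hγL : p.γ * maxSmoothness L ≤ p.β * initError f p / (p.α + initError f p))
    (z : Noise n d K) (k : ℕ) (i : Fin n) :
    ‖∇ (f i) (iterate f p z k) - (state f p z k).g i‖ ≤ initError f p := by
  induction k with
  | zero => exact le_ciSup (f := fun i => ‖∇ (f i) p.x₀ - p.g₀ i‖) (Set.finite_range _).bddAbove i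
  | succ k ih =>
    have h1 := norm_sub_smoothedNormalize_le hβα hα ih
    have h2 : ‖∇ (f i) (iterate f p z (k + 1)) - ∇ (f i) (iterate f p z k)‖ ≤
        p.γ * maxSmoothness L := by
      refine ((hf i).2 _ _).trans ?_
      rw [mul_comm p.γ]
      exact mul_le_mul (le_maxSmoothness L i) (norm_iterate_succ_sub_le hγ z k) (norm_nonneg _) hL
    have h3 : ∇ (f i) (iterate f p z (k + 1)) - (state f p z (k + 1)).g i =
        (∇ (f i) (iterate f p z (k + 1)) - ∇ (f i) (iterate f p z k)) +
        ((∇ (f i) (iterate f p z k) - (state f p z k).g i) - p.β • smoothedNormalize p.α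
          (∇ (f i) (iterate f p z k) - (state f p z k).g i)) := by
      simp only [state, step, localUpdate, iterate]
      abel
    rw [h3]
    linarith [norm_add_le (∇ (f i) (iterate f p z (k + 1)) - ∇ (f i) (iterate f p z k))
      ((∇ (f i) (iterate f p z k) - (state f p z k).g i) - p.β • smoothedNormalize p.α
          (∇ (f i) (iterate f p z k) - (state f p z k).g i))]

/-- The sum of all the noise vectors drawn before iteration `k`. -/
def noiseSum (z : Noise n d K) (k : ℕ) : E d :=
  ∑ l : Fin (K + 1), if (l : ℕ) < k then ∑ i, z l i else 0

theorem noiseSum_succ (z : Noise n d K) {k : ℕ} (hk : k < K + 1) :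
    noiseSum z (k + 1) = noiseSum z k + ∑ i, z ⟨k, hk⟩ i := by
  have h : ∀ l : Fin (K + 1), (if (l : ℕ) < k + 1 then ∑ i, z l i else 0) =
      (if (l : ℕ) < k then ∑ i, z l i else 0) + if l = ⟨k, hk⟩ then ∑ i, z l i else 0 := by
    intro l
    rcases lt_trichotomy (l : ℕ) k with h | h | h
    · simp [h, h.trans k.lt_succ_self, Fin.ext_iff, h.ne]
    · simp [Fin.ext_iff, h]
    · simp [h.not_gt, Fin.ext_iff, h.ne', h.not_ge]
  simp only [noiseSum, h, Finset.sum_add_distrib, Finset.sum_ite_eq', Finset.mem_univ, if_true]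

theorem ghat_eq (z : Noise n d K) {k : ℕ} (hk : k ≤ K + 1) :
    (state f p z k).ghat =
      (1 / (n : ℝ)) • ∑ i, (state f p z k).g i + (p.β / n) • noiseSum z k := by
  induction k with
  | zero => simp [state, initState, noiseSum]
  | succ k ih =>
    rw [state_succ f p z hk, noiseSum_succ z hk]
    simp only [step, serverMemory, message, ih (Nat.le_of_succ_le hk), Finset.sum_add_distrib,
      ← Finset.smul_sum, smul_add, smul_smul]
    rw [one_div_mul_eq_div]
    abel

theorem norm_gradient_sub_ghat_le (hn : 0 < n) {L : Fin n → ℝ} (hf : ∀ i, IsSmooth (f i) (L i))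
    (hα : 0 < p.α) (hβ : 0 ≤ p.β) (hβα : p.β ≤ p.α) (hγ : 0 ≤ p.γ) (hL : 0 ≤ maxSmoothness L)
    (hγL : p.γ * maxSmoothness L ≤ p.β * initError f p / (p.α + initError f p))
    (z : Noise n d K) {k : ℕ} (hk : k < K + 1) :
    ‖∇ (avg f) (iterate f p z k) - (state f p z (k + 1)).ghat‖ ≤
      initError f p - p.β * initError f p / (p.α + initError f p) +
        p.β / n * ‖noiseSum z (k + 1)‖ := by
  have h : ∇ (avg f) (iterate f p z k) - (state f p z (k + 1)).ghat =
      (1 / (n : ℝ)) • ∑ i, (∇ (f i) (iterate f p z k) - (state f p z (k + 1)).g i) -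
        (p.β / n) • noiseSum z (k + 1) := by
    rw [ghat_eq z (k := k + 1) hk, gradient_avg fun i => (hf i).1, Finset.sum_sub_distrib, smul_sub]
    abel
  rw [h]
  refine (norm_sub_le _ _).trans (add_le_add (norm_smul_sum_le hn fun i => ?_) ?_)
  · rw [show ∇ (f i) (iterate f p z k) - (state f p z (k + 1)).g i =
        (∇ (f i) (iterate f p z k) - (state f p z k).g i) - p.β • smoothedNormalize p.α
          (∇ (f i) (iterate f p z k) - (state f p z k).g i) by
      simp only [state, step, localUpdate, iterate]
      abel]
    exact norm_sub_smoothedNormalize_le hβα hα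
      (norm_gradient_sub_memory_le hf hα hβα hγ hL hγL z k i)
  · rw [norm_smul, Real.norm_of_nonneg (by positivity)]

/-- The telescoped descent along a run. The terms `βR/(α + R)` gained by the memory updates absorb
the quadratic terms of the descent inequality. -/
theorem sum_norm_gradient_le (hn : 0 < n) {L : Fin n → ℝ} (hf : ∀ i, IsSmooth (f i) (L i))
    (hα : 0 < p.α) (hβ : 0 ≤ p.β) (hβα : p.β ≤ p.α) (hγ : 0 ≤ p.γ) (hL : 0 ≤ maxSmoothness L)
    (hγL : p.γ * maxSmoothness L ≤ p.β * initError f p / (p.α + initError f p))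
    (z : Noise n d K) {m : ℕ} (hm : m ≤ K + 1) :
    p.γ * ∑ k ∈ Finset.range m, ‖∇ (avg f) (iterate f p z k)‖ ≤
      avg f p.x₀ - avg f (iterate f p z m) + m * (2 * p.γ * initError f p) +
        2 * p.γ * (p.β / n) * ∑ k ∈ Finset.range m, ‖noiseSum z (k + 1)‖ := by
  induction m with
  | zero => simp [iterate, state, initState]
  | succ m ih =>
    have h1 := (isSmooth_avg hn hf).normalized_step_le hL hγ (iterate f p z m)
      (state f p z (m + 1)).ghat
    have h2 := norm_gradient_sub_ghat_le hn hf hα hβ hβα hγ hL hγL z (k := m) hm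
    have h3 : iterate f p z m - p.γ • (‖(state f p z (m + 1)).ghat‖⁻¹ • (state f p z (m + 1)).ghat)
        = iterate f p z (m + 1) := rfl
    rw [h3] at h1
    have h4 := ih (Nat.le_of_succ_le hm)
    rw [Finset.sum_range_succ, Finset.sum_range_succ]
    push_cast
    nlinarith [mul_le_mul_of_nonneg_left h2 hγ, mul_le_mul_of_nonneg_left hγL hγ,
      mul_nonneg hγ (mul_nonneg hγ hL)]

end Run

/-! ### Moments of the accumulated noise -/

section Moments

/-- `X` is square-integrable with mean zero and variance `s`. -/
def IsCentered {Ω : Type*} [MeasurableSpace Ω] (μ : Measure Ω) (X : Ω → ℝ) (s : ℝ) : Prop :=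
  MemLp X 2 μ ∧ ∫ ω, X ω ∂μ = 0 ∧ Var[X; μ] = s

/-- Variances of independent centered variables add up. -/
theorem IsCentered.pi_sum {ι : Type*} [Fintype ι] {Ω : Type*} [MeasurableSpace Ω] {μ : Measure Ω}
    [IsProbabilityMeasure μ] {X : ι → Ω → ℝ} {s : ι → ℝ} (h : ∀ i, IsCentered μ (X i) (s i)) :
    IsCentered (Measure.pi fun _ : ι => μ) (fun ω => ∑ i, X i (ω i)) (∑ i, s i) := by
  have hmp : ∀ i, MeasurePreserving (Function.eval i) (Measure.pi fun _ : ι => μ) μ :=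
    fun i => measurePreserving_eval (fun _ : ι => μ) i
  have hL : ∀ i, MemLp (fun ω : ι → Ω => X i (ω i)) 2 (Measure.pi fun _ : ι => μ) :=
    fun i => (h i).1.comp_measurePreserving (hmp i)
  refine ⟨memLp_finsetSum _ fun i _ => hL i, ?_, ?_⟩
  · rw [integral_finsetSum _ fun i _ => (hL i).integrable one_le_two]
    refine Finset.sum_eq_zero fun i _ => ?_
    rw [integral_comp_eval (μ := fun _ : ι => μ) (h i).1.aestronglyMeasurable, (h i).2.1]
  · have := variance_sum_pi (μ := fun _ : ι => μ) (X := X) fun i => (h i).1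
    rw [Finset.sum_fn] at this
    rw [this]
    exact Finset.sum_congr rfl fun i _ => (h i).2.2

theorem isCentered_zero {Ω : Type*} [MeasurableSpace Ω] (μ : Measure Ω) :
    IsCentered μ (fun _ => 0) 0 :=
  ⟨MemLp.zero', by simp, variance_zero μ⟩

theorem isCentered_gaussianNoise (d : ℕ) (σ : ℝ) (c : Fin d) :
    IsCentered (gaussianNoise d σ) (fun z => z c) (σ ^ 2) := by
  have e' : (gaussianNoise d σ).map (fun z => z c) = (gaussianReal 0 1).map (σ * ·) := by
    rw [gaussianNoise_eq_map_pi, Measure.map_map (by fun_prop) (by fun_prop)]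
    conv_rhs =>
      rw [← (measurePreserving_eval (fun _ : Fin d => gaussianReal 0 1) c).map_eq,
        Measure.map_map (by fun_prop) (by fun_prop)]
    rfl
  rw [gaussianReal_map_const_mul] at e'
  have hm : AEMeasurable (fun z : E d => z c) (gaussianNoise d σ) := by fun_prop
  refine ⟨?_, ?_, ?_⟩
  · have : MemLp (id : ℝ → ℝ) 2 ((gaussianNoise d σ).map (fun z => z c)) := by
      rw [e']
      exact memLp_id_gaussianReal 2
    exact (memLp_map_measure_iff this.1 hm).1 this
  · have := integral_map hm (f := id) aestronglyMeasurable_id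
    rw [e'] at this
    simpa using this.symm
  · have := variance_map (X := id) aemeasurable_id hm
    rw [e', variance_id_gaussianReal] at this
    exact this.symm.trans (by simp)

variable {n d K : ℕ}

theorem isCentered_noiseSum (σ : ℝ) (k : ℕ) (c : Fin d) :
    IsCentered (noiseLaw n d K σ) (fun z => noiseSum z k c)
      (∑ l : Fin (K + 1), if (l : ℕ) < k then n * σ ^ 2 else 0) := by
  have h1 : IsCentered (Measure.pi fun _ : Fin n => gaussianNoise d σ)
      (fun w => ∑ i, w i c) (n * σ ^ 2) := by
    simpa using IsCentered.pi_sum fun _ : Fin n => isCentered_gaussianNoise d σ c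
  have h2 : ∀ l : Fin (K + 1), IsCentered (Measure.pi fun _ : Fin n => gaussianNoise d σ)
      (fun w => if (l : ℕ) < k then ∑ i, w i c else 0)
      (if (l : ℕ) < k then n * σ ^ 2 else 0) := by
    intro l
    split_ifs
    · exact h1
    · exact isCentered_zero _
  have h3 := IsCentered.pi_sum h2
  have e : (fun z : Noise n d K => noiseSum z k c) =
      fun z => ∑ l : Fin (K + 1), if (l : ℕ) < k then ∑ i, z l i c else 0 := by
    funext z
    rw [noiseSum, WithLp.ofLp_sum, Finset.sum_apply]
    refine Finset.sum_congr rfl fun l _ => ?_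
    split_ifs <;> simp
  rw [e]
  exact h3

theorem integrable_norm_noiseSum_and_integral_le (σ : ℝ) (hσ : 0 ≤ σ) (k : ℕ) :
    Integrable (fun z => ‖noiseSum z k‖) (noiseLaw n d K σ) ∧
    ∫ z, ‖noiseSum z k‖ ∂(noiseLaw n d K σ) ≤ σ * √((K + 1) * n * d) := by
  have hc := fun c => isCentered_noiseSum (n := n) (d := d) (K := K) σ k c
  have hv : ∀ c : Fin d, Integrable (fun z => noiseSum z k c ^ 2) (noiseLaw n d K σ) ∧
      ∫ z, noiseSum z k c ^ 2 ∂(noiseLaw n d K σ) ≤ (K + 1) * (n * σ ^ 2) := by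
    intro c
    refine ⟨(hc c).1.integrable_sq, ?_⟩
    rw [← variance_of_integral_eq_zero (hc c).1.1.aemeasurable (hc c).2.1, (hc c).2.2]
    calc ∑ l : Fin (K + 1), (if (l : ℕ) < k then n * σ ^ 2 else 0)
        ≤ ∑ l : Fin (K + 1), n * σ ^ 2 := Finset.sum_le_sum fun l _ => by
          split_ifs
          · exact le_rfl
          · positivity
      _ = (K + 1) * (n * σ ^ 2) := by simp
  have hsq : ∀ z : Noise n d K, ‖noiseSum z k‖ ^ 2 = ∑ c, noiseSum z k c ^ 2 :=
    fun z => EuclideanSpace.real_norm_sq_eq _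
  have hint : Integrable (fun z : Noise n d K => ‖noiseSum z k‖ ^ 2) (noiseLaw n d K σ) := by
    simp only [hsq]
    exact integrable_finsetSum _ fun c _ => (hv c).1
  have hmeas : Measurable fun z : Noise n d K => noiseSum z k := by
    unfold noiseSum
    refine Finset.measurable_sum _ fun l _ => ?_
    split_ifs <;> fun_prop
  have hL2 : MemLp (fun z : Noise n d K => ‖noiseSum z k‖) 2 (noiseLaw n d K σ) :=
    (memLp_two_iff_integrable_sq hmeas.norm.aestronglyMeasurable).2 hint
  refine ⟨hL2.integrable one_le_two, ?_⟩
  have h1 : ∫ z : Noise n d K, ‖noiseSum z k‖ ^ 2 ∂(noiseLaw n d K σ) ≤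
      σ ^ 2 * ((K + 1) * n * d) := by
    simp only [hsq]
    rw [integral_finsetSum _ fun c _ => (hv c).1]
    refine (Finset.sum_le_sum fun c _ => (hv c).2).trans (le_of_eq ?_)
    simp
    ring
  have h2 := variance_nonneg (fun z : Noise n d K => ‖noiseSum z k‖) (noiseLaw n d K σ)
  rw [variance_eq_sub hL2] at h2
  simp only [Pi.pow_apply] at h2
  refine le_of_sq_le_sq ?_ (by positivity)
  rw [mul_pow, Real.sq_sqrt (by positivity)]
  linarith

end Moments

/-! ### The expected gradient norm -/

section Utility

variable {n d K : ℕ} {f : Fin n → E d → ℝ} {p : Params n d}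

theorem integrable_norm_gradient_iterate {Lf : ℝ} (hf : IsSmooth (avg f) Lf)
    (hγ : 0 ≤ p.γ) (σ : ℝ) (k : ℕ) :
    Integrable (fun z : Noise n d K => ‖∇ (avg f) (iterate f p z k)‖) (noiseLaw n d K σ) := by
  refine Integrable.of_bound (C := ‖∇ (avg f) p.x₀‖ + |Lf| * (k * p.γ))
    ((measurable_gradient _).comp (measurable_state f p k).1).norm.aestronglyMeasurable
    (Filter.Eventually.of_forall fun z => ?_)
  rw [norm_norm]
  have h1 := norm_le_norm_add_norm_sub' (∇ (avg f) (iterate f p z k)) (∇ (avg f) p.x₀)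
  have h2 := hf.2 (iterate f p z k) p.x₀
  have h3 : Lf * ‖iterate f p z k - p.x₀‖ ≤ |Lf| * (k * p.γ) :=
    mul_le_mul (le_abs_self _) (norm_iterate_sub_le hγ z k) (norm_nonneg _) (abs_nonneg _)
  linarith

theorem inf'_integral_norm_gradient_le (hn : 0 < n) {L : Fin n → ℝ}
    (hf : ∀ i, IsSmooth (f i) (L i)) {finf : ℝ} (hinf : ∀ x, finf ≤ avg f x) {σ : ℝ} (hσ : 0 ≤ σ)
    (hα : 0 < p.α) (hβ : 0 ≤ p.β) (hβα : p.β ≤ p.α) (hγ : 0 < p.γ) (hL : 0 ≤ maxSmoothness L)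
    (hγL : p.γ * maxSmoothness L ≤ p.β * initError f p / (p.α + initError f p)) :
    (Finset.range (K + 1)).inf' Finset.nonempty_range_add_one
      (fun k => ∫ z : Noise n d K, ‖∇ (avg f) (iterate f p z k)‖ ∂(noiseLaw n d K σ)) ≤
    (avg f p.x₀ - finf) / (p.γ * (K + 1)) + 2 * initError f p +
      2 * (p.β / n) * (σ * √((K + 1) * n * d)) := by
  set m := (Finset.range (K + 1)).inf' Finset.nonempty_range_add_one
      (fun k => ∫ z : Noise n d K, ‖∇ (avg f) (iterate f p z k)‖ ∂(noiseLaw n d K σ)) with hm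
  set B := σ * √((K + 1) * n * d)
  have hI := fun k => integrable_norm_gradient_iterate (K := K) (isSmooth_avg hn hf) hγ.le σ k
  have hS := fun k => integrable_norm_noiseSum_and_integral_le (n := n) (d := d) (K := K) σ hσ k
  have h1 : (K + 1) * m ≤
      ∑ k ∈ Finset.range (K + 1),
        ∫ z : Noise n d K, ‖∇ (avg f) (iterate f p z k)‖ ∂(noiseLaw n d K σ) := by
    have := Finset.card_nsmul_le_sum (Finset.range (K + 1)) (fun k =>
      ∫ z : Noise n d K, ‖∇ (avg f) (iterate f p z k)‖ ∂(noiseLaw n d K σ)) m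
      fun k hk => Finset.inf'_le _ hk
    simpa using this
  have h2 : p.γ * ∑ k ∈ Finset.range (K + 1),
        ∫ z : Noise n d K, ‖∇ (avg f) (iterate f p z k)‖ ∂(noiseLaw n d K σ) ≤
      avg f p.x₀ - finf + (K + 1) * (2 * p.γ * initError f p) + 2 * p.γ * (p.β / n) *
        ∑ k ∈ Finset.range (K + 1), ∫ z : Noise n d K, ‖noiseSum z (k + 1)‖
          ∂(noiseLaw n d K σ) := by
    rw [← integral_finsetSum _ fun k _ => hI k, ← integral_const_mul,
      ← integral_finsetSum _ fun k _ => (hS (k + 1)).1, ← integral_const_mul]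
    have hSi := (integrable_finsetSum (Finset.range (K + 1)) fun k _ =>
      (hS (k + 1)).1).const_mul (2 * p.γ * (p.β / n))
    have h3 := integral_mono ((integrable_finsetSum (Finset.range (K + 1)) fun k _ =>
      hI k).const_mul p.γ) ((integrable_const (avg f p.x₀ - finf +
        (K + 1) * (2 * p.γ * initError f p))).add hSi) (fun z => by
        have := sum_norm_gradient_le hn hf hα hβ hβα hγ.le hL hγL z (m := K + 1) le_rfl
        push_cast at this
        simp only [Pi.add_apply]
        linarith [hinf (iterate f p z (K + 1))])
    rw [integral_add' (integrable_const _) hSi] at h3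
    simpa using h3
  have h4 : ∑ k ∈ Finset.range (K + 1), ∫ z : Noise n d K, ‖noiseSum z (k + 1)‖
      ∂(noiseLaw n d K σ) ≤ (K + 1) * B := by
    refine (Finset.sum_le_sum fun k _ => (hS (k + 1)).2).trans ?_
    simp [B]
  have h5 : 2 * p.γ * (p.β / n) * ∑ k ∈ Finset.range (K + 1), ∫ z : Noise n d K,
      ‖noiseSum z (k + 1)‖ ∂(noiseLaw n d K σ) ≤ 2 * p.γ * (p.β / n) * ((K + 1) * B) := by
    gcongr
  have h6 := mul_le_mul_of_nonneg_left h1 hγ.le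
  have hK : (0 : ℝ) < K + 1 := by positivity
  have h7 : m * (p.γ * (K + 1)) ≤ avg f p.x₀ - finf +
      (2 * initError f p + 2 * (p.β / n) * B) * (p.γ * (K + 1)) := by
    linarith
  have h8 : avg f p.x₀ - finf = (avg f p.x₀ - finf) / (p.γ * (K + 1)) * (p.γ * (K + 1)) := by
    field_simp
  rw [h8, ← add_mul] at h7
  have := le_of_mul_le_mul_right h7 (by positivity)
  linarith

end Utility

/-! ### Choice of the parameters -/

section Parameters

/-- The term `(f(x⁰) - f^inf) / (γ (K + 1))` of the utility bound, with `k = K + 1` and `q` the fourth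
root of `n ε² / (d log(1/δ))`. -/
theorem optimization_term_le {α β β₀ γ θ R Lmax gap q k : ℝ} (hα : 0 < α) (hR : 0 < R)
    (hL : 0 < Lmax) (hgap : 0 ≤ gap) (hk : 0 < k) (hθ : 0 < θ) (hβ₀ : 0 < β₀) (hq : 0 < q)
    (hβ : β = β₀ / k) (hle : β₀ ≤ √(Lmax * (α + R) * gap / R) * q)
    (hge : θ * (√(Lmax * (α + R) * gap / R) * q) ≤ β₀)
    (hγ : θ * (β * R / (α + R) * (1 / Lmax)) ≤ γ) :
    gap / (γ * k) ≤ 1 / θ ^ 2 * (√(Lmax * (α + R) * gap / R) * q⁻¹) := by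
  have hD2 : √(Lmax * (α + R) * gap / R) ^ 2 = Lmax * (α + R) * gap / R :=
    Real.sq_sqrt (by positivity)
  set D := √(Lmax * (α + R) * gap / R)
  have hD : 0 < D := pos_of_mul_pos_left (hβ₀.trans_le hle) hq.le
  have hgapeq : gap = D ^ 2 * R / (Lmax * (α + R)) := by
    rw [hD2]
    field_simp
  have h1 : θ ^ 2 * (D * q) * R / ((α + R) * Lmax) ≤ γ * k := by
    have h2 : θ * (β₀ * R / (α + R) * (1 / Lmax)) ≤ γ * k := by
      refine le_trans (le_of_eq ?_) (mul_le_mul_of_nonneg_right hγ hk.le)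
      rw [hβ]
      field_simp
    refine le_trans ?_ h2
    rw [show θ ^ 2 * (D * q) * R / ((α + R) * Lmax) =
      θ * ((θ * (D * q)) * R / (α + R) * (1 / Lmax)) by field_simp]
    gcongr
  calc gap / (γ * k) ≤ gap / (θ ^ 2 * (D * q) * R / ((α + R) * Lmax)) := by gcongr
    _ = 1 / θ ^ 2 * (D * q⁻¹) := by
      rw [hgapeq]
      field_simp

/-- The term of the utility bound that comes from the noise, with `k = K + 1` and
`l = log(1/δ)`. -/
theorem noise_term_le {n d : ℕ} {β β₀ σ C D k ε l : ℝ} (hn : 0 < n) (hd : 0 < d) (hk : 0 < k)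
    (hε : 0 < ε) (hl : 0 < l) (hC : 0 ≤ C) (hβ₀ : 0 < β₀) (hβ : β = β₀ / k)
    (hle : β₀ ≤ D * ((n : ℝ) * ε ^ 2 / (d * l)) ^ (1 / 4 : ℝ)) (hσ : σ ≤ C * (√(k * l) / ε)) :
    2 * (β / n) * (σ * √(k * n * d)) ≤
      2 * C * (D * (((n : ℝ) * ε ^ 2 / (d * l)) ^ (1 / 4 : ℝ))⁻¹) := by
  have hn' : (0 : ℝ) < n := Nat.cast_pos.2 hn
  have hd' : (0 : ℝ) < d := Nat.cast_pos.2 hd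
  have hq4 : (((n : ℝ) * ε ^ 2 / (d * l)) ^ (1 / 4 : ℝ)) ^ 4 = n * ε ^ 2 / (d * l) := by
    rw [← Real.rpow_natCast, ← Real.rpow_mul (by positivity)]
    norm_num
  have hq : 0 < ((n : ℝ) * ε ^ 2 / (d * l)) ^ (1 / 4 : ℝ) := by positivity
  set q := ((n : ℝ) * ε ^ 2 / (d * l)) ^ (1 / 4 : ℝ)
  have hs : √(k * l) * √(k * n * d) = k * n * ε / q ^ 2 := by
    rw [← Real.sqrt_mul (by positivity), Real.sqrt_eq_iff_eq_sq (by positivity) (by positivity), div_pow,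
      ← pow_mul, hq4]
    field_simp
  calc 2 * (β / n) * (σ * √(k * n * d))
      ≤ 2 * (β / n) * (C * (√(k * l) / ε) * √(k * n * d)) := by
        have : 0 ≤ β := by
          rw [hβ]
          positivity
        gcongr
    _ = 2 * (β / n) * (C / ε * (√(k * l) * √(k * n * d))) := by ring
    _ = 2 * C * (β₀ / q ^ 2) := by
        rw [hs, hβ]
        field_simp
    _ ≤ 2 * C * (D * q / q ^ 2) := by gcongr
    _ = 2 * C * (D * q⁻¹) := by
        field_simp

end Parameters

end NormEC

end

theorem corollary2 :
    -- `κ` bounds `ε / log(1/δ)`; `c₀` and `C` are the constants in `σ_DP = O(√((K+1)log(1/δ))/ε)`;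
    -- `θ` bounds from below how close `β₀` and `γ` are to their largest allowed values;
    -- `M` is the constant in the utility bound.
    ∀ κ : ℝ, 0 < κ → ∃ c₀ : ℝ, 0 < c₀ ∧
    ∀ C θ : ℝ, c₀ ≤ C → 0 < θ → ∃ M : ℝ, 0 < M ∧
    ∀ (n d K : ℕ) (_hn : 0 < n) (_hd : 0 < d)
      -- the problem: `fᵢ` is `Lᵢ`-smooth, `f` is `Lf`-smooth and bounded below by `finf`
      (f : Fin n → NormEC.E d → ℝ) (L : Fin n → ℝ) (Lf finf : ℝ)
      (_hL : ∀ i, NormEC.IsSmooth (f i) (L i))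
      (_hLf : NormEC.IsSmooth (NormEC.avg f) Lf)
      (_hinf : ∀ x, finf ≤ NormEC.avg f x)
      -- the privacy level and the standard deviation of the noise
      (ε δ σ : ℝ) (_hε : 0 < ε) (_hδ : 0 < δ) (_hδ1 : δ < 1)
      (_hεδ : ε ≤ κ * Real.log (1 / δ))
      (_hσ : c₀ * (Real.sqrt ((K + 1 : ℝ) * Real.log (1 / δ)) / ε) ≤ σ)
      (_hσ' : σ ≤ C * (Real.sqrt ((K + 1 : ℝ) * Real.log (1 / δ)) / ε))
      -- the inputs of the algorithm
      (p : NormEC.Params n d) (β₀ : ℝ) (_hβ₀ : 0 < β₀)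
      (_hβ : p.β = β₀ / (K + 1 : ℝ)) (_hα : β₀ < p.α)
      (_hR : 0 < NormEC.initError f p)
      (_hβ₀le : β₀ ≤ NormEC.Delta f p L finf *
        ((n : ℝ) * ε ^ 2 / ((d : ℝ) * Real.log (1 / δ))) ^ (1 / 4 : ℝ))
      (_hβ₀ge : θ * (NormEC.Delta f p L finf *
        ((n : ℝ) * ε ^ 2 / ((d : ℝ) * Real.log (1 / δ))) ^ (1 / 4 : ℝ)) ≤ β₀)
      (_hγ : 0 < p.γ)
      (_hγle : p.γ ≤ p.β * NormEC.initError f p / (p.α + NormEC.initError f p) *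
        (1 / NormEC.maxSmoothness L))
      (_hγge : θ * (p.β * NormEC.initError f p / (p.α + NormEC.initError f p) *
        (1 / NormEC.maxSmoothness L)) ≤ p.γ),
      NormEC.IsDifferentiallyPrivate NormEC.Neighbouring (NormEC.mechanism K σ p) ε δ ∧
      (∀ k ∈ Finset.range (K + 1), MeasureTheory.Integrable
        (fun z : NormEC.Noise n d K => ‖gradient (NormEC.avg f) (NormEC.iterate f p z k)‖)
        (NormEC.noiseLaw n d K σ)) ∧
      (Finset.range (K + 1)).inf' Finset.nonempty_range_add_one
        (fun k => ∫ z : NormEC.Noise n d K,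
          ‖gradient (NormEC.avg f) (NormEC.iterate f p z k)‖ ∂(NormEC.noiseLaw n d K σ)) ≤
        M * (NormEC.Delta f p L finf *
          ((d : ℝ) * Real.log (1 / δ) / ((n : ℝ) * ε ^ 2)) ^ (1 / 4 : ℝ)) +
          2 * NormEC.initError f p := by
  intro κ hκ
  refine ⟨2 * √(κ + 2), by positivity, fun C θ hC hθ => ?_⟩
  have hC0 : 0 < C := lt_of_lt_of_le (by positivity) hC
  refine ⟨1 / θ ^ 2 + 2 * C, by positivity, ?_⟩
  intro n d K hn hd f L Lf finf hf hLf hinf ε δ σ hε hδ hδ1 hεδ hσ hσ' p β₀ hβ₀ hβ hβα hR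
    hβ₀le hβ₀ge hγ hγle hγge
  have hα : 0 < p.α := hβ₀.trans hβα
  have hK : (0 : ℝ) < K + 1 := by positivity
  have hβ0 : 0 < p.β := by
    rw [hβ]
    positivity
  have hβle : p.β ≤ p.α := by
    rw [hβ]
    exact (div_le_self hβ₀.le (by linarith [K.cast_nonneg (α := ℝ)])).trans hβα.le
  -- a positive step size below the upper bound forces `L_max > 0`
  have hL : 0 < NormEC.maxSmoothness L := by
    by_contra hL
    have h1 : 1 / NormEC.maxSmoothness L ≤ 0 := one_div_nonpos.2 (not_lt.1 hL)
    have h2 : 0 ≤ p.β * NormEC.initError f p / (p.α + NormEC.initError f p) := by positivity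
    linarith [mul_nonpos_of_nonneg_of_nonpos h2 h1]
  have hγL : p.γ * NormEC.maxSmoothness L ≤
      p.β * NormEC.initError f p / (p.α + NormEC.initError f p) := by
    rwa [mul_one_div, le_div_iff₀ hL] at hγle
  have hl : 0 < Real.log (1 / δ) := Real.log_pos (by rw [lt_div_iff₀ hδ]; linarith)
  have hσ0 : 0 < σ := lt_of_lt_of_le (by positivity) hσ
  refine ⟨NormEC.isDifferentiallyPrivate_mechanism_of_le p hα hκ hε hδ hδ1 hεδ hσ,
    fun k _ => NormEC.integrable_norm_gradient_iterate hLf hγ.le σ k, ?_⟩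
  refine (NormEC.inf'_integral_norm_gradient_le hn hf hinf hσ0.le hα hβ0.le hβle hγ hL.le
    hγL).trans ?_
  have h1 := NormEC.optimization_term_le hα hR hL (sub_nonneg.2 (hinf p.x₀)) hK hθ hβ₀
    (by positivity) hβ hβ₀le hβ₀ge hγge
  have h2 := NormEC.noise_term_le hn hd hK hε hl hC0.le hβ₀ hβ hβ₀le hσ'
  have h3 : ((d : ℝ) * Real.log (1 / δ) / ((n : ℝ) * ε ^ 2)) ^ (1 / 4 : ℝ) =
      (((n : ℝ) * ε ^ 2 / ((d : ℝ) * Real.log (1 / δ))) ^ (1 / 4 : ℝ))⁻¹ := by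
    rw [← Real.inv_rpow (by positivity), inv_div]
  rw [h3]
  simp only [NormEC.Delta] at h1 h2 ⊢
  linarith
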